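/- Let $\mathcal{E}$ be an exact category in the sense of Quillen: an additive category with a class of kernel--cokernel pairs $0\to X\xrightarrow{i}Y\xrightarrow{d}Z\to 0$, called conflations, closed under isomorphism, such that (calling $i$ an inflation and $d$ a deflation) identities are inflations and deflations, inflations and deflations are closed under composition, pushouts of inflations along arbitrary morphisms exist and are inflations, and pullbacks of deflations along arbitrary morphisms exist and are deflations. Assume that $\mathcal{E}$ is weakly idempotent complete, i.e. every section in $\mathcal{E}$ has a cokernel. A weak factorization system $(\mathcal{L},\mathcal{R})$ in $\mathcal{E}$ is called exact if, for every morphism $f$, one has $f\in\mathcal{L}$ if and only if $f$ is an inflation and $0\to\operatorname{Coker}f$ is in $\mathcal{L}$, and $f\in\mathcal{R}$ if and only if $f$ is a deflation and $\operatorname{Ker}f\to 0$ is in $\mathcal{R}$. An exact model structure on $\mathcal{E}$ is a triple $(\mathrm{Cof},\mathrm{W},\mathrm{Fib})$ of classes of morphisms such that $\mathrm{W}$ is closed under retracts and has the 2-out-of-3 property for composition, and $(\mathrm{Cof},\mathrm{W}\cap\mathrm{Fib})$ and $(\mathrm{Cof}\cap\mathrm{W},\mathrm{Fib})$ are exact weak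 factorization systems. A complete cotorsion pair is a pair $(\mathcal{A},\mathcal{B})$ of classes of objects such that $\mathcal{A}=\{A\mid \operatorname{Ext}^1_{\mathcal{E}}(A,B)=0\text{ for all }B\in\mathcal{B}\}$ and $\mathcal{B}=\{B\mid \operatorname{Ext}^1_{\mathcal{E}}(A,B)=0\text{ for all }A\in\mathcal{A}\}$ (Yoneda $\operatorname{Ext}$), and such that every $X\in\mathcal{E}$ admits conflations $0\to X\to B_X\to A_X\to 0$ and $0\to B^X\to A^X\to X\to 0$ with $A_X,A^X\in\mathcal{A}$ and $B_X,B^X\in\mathcal{B}$. Then there is a bijective correspondence between exact model structures on $\mathcal{E}$ and triples $(\mathcal{C},\mathcal{W},\mathcal{F})$ of classes of objects of $\mathcal{E}$ such that 1. $\mathcal{W}$ is closed under retracts, and if two of the three terms $X,Y,Z$ of a conflation $0\to X\to Y\to Z\to 0$ are in $\mathcal{W}$, then so is the third; 2. $(\mathcal{C},\mathcal{W}\cap\mathcal{F})$ and $(\mathcal{C}\cap\mathcal{W},\mathcal{F})$ are complete cotorsion pairs in $\mathcal{E}$. The correspondence assigns to $(\mathcal{C},\mathcal{W},\mathcal{F})$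 the exact model structure $(\mathrm{Cof},\mathrm{W},\mathrm{Fib})$ such that (a) $c\in\mathrm{Cof}$ if and only if $c$ is an inflation with cokernel in $\mathcal{C}$; (b) $w\in\mathrm{W}$ if and only if $w=w_dw_i$ for an inflation $w_i$ with cokernel in $\mathcal{W}$ and a deflation $w_d$ with kernel in $\mathcal{W}$; (c) $f\in\mathrm{Fib}$ if and only if $f$ is a deflation with kernel in $\mathcal{F}$. The inverse assigns to $(\mathrm{Cof},\mathrm{W},\mathrm{Fib})$ the triple $(\mathcal{C},\mathcal{W},\mathcal{F})$ in which $\mathcal{C}$ is the class of cofibrant objects ($0\to X$ in $\mathrm{Cof}$), $\mathcal{W}$ is the class of trivial objects ($0\to X$ in $\mathrm{W}$), and $\mathcal{F}$ is the class of fibrant objects ($X\to 0$ in $\mathrm{Fib}$). -/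

import Mathlib

open CategoryTheory CategoryTheory.Limits
open scoped ZeroObject

universe v u

/-- A category is weakly idempotent complete if every section has a cokernel. -/
def WeaklyIdempotentComplete (E : Type u) [Category.{v} E] [Preadditive E] : Prop :=
  ∀ ⦃X Y : E⦄ (s : X ⟶ Y), IsSplitMono s → HasCokernel s

section Inflations

variable {E : Type u} [Category.{v} E] [Preadditive E]

/-- Given a class of short sequences `X ⟶ Y ⟶ Z`, the morphisms occurring as the first map
of a sequence whose third term lies in `A`. -/
def firstMaps (conf : ObjectProperty (ShortComplex E)) (A : ObjectProperty E) :
    MorphismProperty E :=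
  fun _ _ i => ∃ (Z : E) (p : _ ⟶ Z) (w : i ≫ p = 0), conf (ShortComplex.mk i p w) ∧ A Z

/-- Given a class of short sequences `X ⟶ Y ⟶ Z`, the morphisms occurring as the second map
of a sequence whose first term lies in `B`. -/
def secondMaps (conf : ObjectProperty (ShortComplex E)) (B : ObjectProperty E) :
    MorphismProperty E :=
  fun _ _ p => ∃ (K : E) (i : K ⟶ _) (w : i ≫ p = 0), conf (ShortComplex.mk i p w) ∧ B K

end Inflations

/-- A Quillen exact structure on an additive category: a class of kernel-cokernel pairs
(the conflations), closed under isomorphism, such that identities are inflations and deflations,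
inflations and deflations are closed under composition, pushouts of inflations along arbitrary
morphisms exist and are inflations, and pullbacks of deflations along arbitrary morphisms exist
and are deflations. -/
structure ExactStructure (E : Type u) [Category.{v} E] [Preadditive E] [HasZeroObject E]
    [HasBinaryBiproducts E] where
  conflation : ObjectProperty (ShortComplex E)
  isClosedUnderIsomorphisms : conflation.IsClosedUnderIsomorphisms
  isKernel : ∀ S : ShortComplex E, conflation S → Nonempty (IsLimit (KernelFork.ofι S.f S.zero))
  isCokernel : ∀ S : ShortComplex E, conflation S →
    Nonempty (IsColimit (CokernelCofork.ofπ S.g S.zero))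
  inflation_id : ∀ X : E, firstMaps conflation ⊤ (𝟙 X)
  deflation_id : ∀ X : E, secondMaps conflation ⊤ (𝟙 X)
  inflation_comp : ∀ {X Y Z : E} (f : X ⟶ Y) (g : Y ⟶ Z),
    firstMaps conflation ⊤ f → firstMaps conflation ⊤ g → firstMaps conflation ⊤ (f ≫ g)
  deflation_comp : ∀ {X Y Z : E} (f : X ⟶ Y) (g : Y ⟶ Z),
    secondMaps conflation ⊤ f → secondMaps conflation ⊤ g → secondMaps conflation ⊤ (f ≫ g)
  inflation_pushout : ∀ {X Y X' : E} (i : X ⟶ Y) (f : X ⟶ X'), firstMaps conflation ⊤ i →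
    ∃ (Y' : E) (f' : Y ⟶ Y') (i' : X' ⟶ Y'), IsPushout i f f' i' ∧ firstMaps conflation ⊤ i'
  deflation_pullback : ∀ {Y Z Z' : E} (p : Y ⟶ Z) (g : Z' ⟶ Z), secondMaps conflation ⊤ p →
    ∃ (Y' : E) (g' : Y' ⟶ Y) (p' : Y' ⟶ Z'), IsPullback g' p' p g ∧ secondMaps conflation ⊤ p'

namespace ExactStructure

variable {E : Type u} [Category.{v} E] [Preadditive E] [HasZeroObject E] [HasBinaryBiproducts E]
  (X : ExactStructure E)

/-- The inflations with cokernel in `A`. -/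
def Infl (A : ObjectProperty E) : MorphismProperty E := firstMaps X.conflation A

/-- The deflations with kernel in `B`. -/
def Defl (B : ObjectProperty E) : MorphismProperty E := secondMaps X.conflation B

/-- A one-step extension of `A` by `B`: a conflation `0 ⟶ B ⟶ M ⟶ A ⟶ 0`. -/
structure Extension (A B : E) where
  M : E
  i : B ⟶ M
  p : M ⟶ A
  zero : i ≫ p = 0
  conflation : X.conflation (ShortComplex.mk i p zero)

/-- The Yoneda `Ext¹(A, B)`: extensions of `A` by `B` modulo the equivalence relation generated
by morphisms of extensions that are the identity on `A` and on `B`. -/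
def YonedaExt (A B : E) : Type (max u v) :=
  Quot (fun ε ε' : X.Extension A B => ∃ h : ε.M ⟶ ε'.M, ε.i ≫ h = ε'.i ∧ h ≫ ε'.p = ε.p)

/-- The class of objects `B` with `Ext¹(A, B) = 0` for all `A` in `S`. -/
def rightPerp (S : ObjectProperty E) : ObjectProperty E :=
  fun B => ∀ A, S A → Subsingleton (X.YonedaExt A B)

/-- The class of objects `A` with `Ext¹(A, B) = 0` for all `B` in `S`. -/
def leftPerp (S : ObjectProperty E) : ObjectProperty E :=
  fun A => ∀ B, S B → Subsingleton (X.YonedaExt A B)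

/-- Complete cotorsion pairs. -/
structure IsCompleteCotorsionPair (A B : ObjectProperty E) : Prop where
  left_eq : A = X.leftPerp B
  right_eq : X.rightPerp A = B
  /-- Every object `Y` has a conflation `0 ⟶ Y ⟶ B' ⟶ A' ⟶ 0`. -/
  exists_left_approx : ∀ Y : E, ∃ (B' A' : E) (i : Y ⟶ B') (p : B' ⟶ A') (w : i ≫ p = 0),
    X.conflation (ShortComplex.mk i p w) ∧ B B' ∧ A A'
  /-- Every object `Y` has a conflation `0 ⟶ B' ⟶ A' ⟶ Y ⟶ 0`. -/
  exists_right_approx : ∀ Y : E, ∃ (B' A' : E) (i : B' ⟶ A') (p : A' ⟶ Y) (w : i ≫ p = 0),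
    X.conflation (ShortComplex.mk i p w) ∧ B B' ∧ A A'

/-- The objects `A` such that `0 ⟶ A` belongs to `L`. -/
def fromZero (L : MorphismProperty E) : ObjectProperty E := fun A => L (0 : (0 : E) ⟶ A)

/-- The objects `B` such that `B ⟶ 0` belongs to `R`. -/
def toZero (R : MorphismProperty E) : ObjectProperty E := fun B => R (0 : B ⟶ (0 : E))

/-- Exact weak factorization systems: `f` is in `L` iff it is an inflation and `0 ⟶ Coker f` is
in `L`; `f` is in `R` iff it is a deflation and `Ker f ⟶ 0` is in `R`. -/
structure IsExactWFS (L R : MorphismProperty E) : Prop where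
  isWeakFactorizationSystem : L.IsWeakFactorizationSystem R
  mem_left_iff : ∀ {Y Z : E} (f : Y ⟶ Z), L f ↔ X.Infl (fromZero L) f
  mem_right_iff : ∀ {Y Z : E} (f : Y ⟶ Z), R f ↔ X.Defl (toZero R) f

/-- Exact model structures on the exact category `(E, X)`. -/
structure ExactModelStructure where
  cof : MorphismProperty E
  weq : MorphismProperty E
  fib : MorphismProperty E
  weq_isStableUnderRetracts : weq.IsStableUnderRetracts
  weq_hasTwoOutOfThreeProperty : weq.HasTwoOutOfThreeProperty
  isExactWFS_cof_trivialFib : X.IsExactWFS cof (weq ⊓ fib)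
  isExactWFS_trivialCof_fib : X.IsExactWFS (cof ⊓ weq) fib

/-- The 2-out-of-3 property for conflations. -/
structure HasTwoOutOfThree (W : ObjectProperty E) : Prop where
  left : ∀ S : ShortComplex E, X.conflation S → W S.X₂ → W S.X₃ → W S.X₁
  middle : ∀ S : ShortComplex E, X.conflation S → W S.X₁ → W S.X₃ → W S.X₂
  right : ∀ S : ShortComplex E, X.conflation S → W S.X₁ → W S.X₂ → W S.X₃

/-- Triples `(C, W, F)` of classes of objects such that `W` is closed under retracts and has the
2-out-of-3 property for conflations, and `(C, W ∩ F)` and `(C ∩ W, F)` are complete cotorsion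
pairs. -/
structure HoveyTriple where
  C : ObjectProperty E
  W : ObjectProperty E
  F : ObjectProperty E
  isStableUnderRetracts : W.IsStableUnderRetracts
  hasTwoOutOfThree : X.HasTwoOutOfThree W
  isCompleteCotorsionPair_cof : X.IsCompleteCotorsionPair C (W ⊓ F)
  isCompleteCotorsionPair_fib : X.IsCompleteCotorsionPair (C ⊓ W) F

end ExactStructure

/-! A lifting problem of an inflation with cokernel `A` against a deflation with kernel `B` is
solvable whenever every extension of `A` by `B` splits (`Orth.hasLiftingProperty`). Complete
cotorsion pairs and exact weak factorization systems are therefore the same data: orthogonality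
gives lifting, approximations give factorizations, and factoring `0 ⟶ Y` and `Y ⟶ 0` recovers the
approximations (`IsCompleteCotorsionPair.isExactWFS`, `IsExactWFS.isCompleteCotorsionPair`). Weak
idempotent completeness enters through the cancellation laws `Conf.of_comp` and `Conf.of_comp'`.

The weak equivalences remain. For a Hovey triple, 2-out-of-3 and closure under retracts are hard to
see on composites of an inflation and a deflation. So `w : A ⟶ B` is called a weak equivalence when
its cone, the cokernel of `(w, j) : A ⟶ B ⊞ J` for an inflation `j` into some `J` in `W`, lies in
`W` (`trivialCone`). This does not depend on `j`; composable maps give a conflation of cones, as in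
the octahedral axiom, and retracts of maps give retracts of cones. For inflations and deflations the
condition says that the cokernel or kernel is in `W`, which yields the factorization description and
identifies the trivial (co)fibrations.

Conversely, in an exact model structure an inflation (deflation) is a weak equivalence exactly when
its cokernel (kernel) is trivial. This gives 2-out-of-3 for conflations and the same description of
weak equivalences, so the two constructions are mutually inverse. -/

namespace ExactStructure

/-! ### Duality for classes of short sequences -/

section Opposites

variable {E : Type u} [Category.{v} E] [Preadditive E]

/-- The opposite of a class of short sequences. -/
def opConflation (c : ObjectProperty (ShortComplex E)) : ObjectProperty (ShortComplex Eᵒᵖ) :=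
  fun S => c S.unop

lemma firstMaps_op_iff (c : ObjectProperty (ShortComplex E)) {A B : Eᵒᵖ} (f : A ⟶ B) :
    firstMaps (opConflation c) ⊤ f ↔ secondMaps c ⊤ f.unop :=
  ⟨fun ⟨C, p, w, h, _⟩ => ⟨C.unop, p.unop, by rw [← unop_comp, w]; rfl, h, trivial⟩,
    fun ⟨C, p, w, h, _⟩ => ⟨.op C, p.op, by rw [← f.op_unop, ← op_comp, w]; rfl, h, trivial⟩⟩

lemma secondMaps_op_iff (c : ObjectProperty (ShortComplex E)) {A B : Eᵒᵖ} (f : A ⟶ B) :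
    secondMaps (opConflation c) ⊤ f ↔ firstMaps c ⊤ f.unop :=
  ⟨fun ⟨C, p, w, h, _⟩ => ⟨C.unop, p.unop, by rw [← unop_comp, w]; rfl, h, trivial⟩,
    fun ⟨C, p, w, h, _⟩ => ⟨.op C, p.op, by rw [← f.op_unop, ← op_comp, w]; rfl, h, trivial⟩⟩

end Opposites

/-! ### Calculus of conflations -/

section Conflations

variable {E : Type u} [Category.{v} E] [Preadditive E] [HasZeroObject E] [HasBinaryBiproducts E]

/-- The pair `(i, p)` is a conflation. -/
def Conf (X : ExactStructure E) {A B C : E} (i : A ⟶ B) (p : B ⟶ C) : Prop :=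
  ∃ w : i ≫ p = 0, X.conflation (ShortComplex.mk i p w)

variable {X : ExactStructure E}

namespace Conf

variable {A B C : E} {i : A ⟶ B} {p : B ⟶ C}

lemma zero (h : X.Conf i p) : i ≫ p = 0 := h.1

lemma exists_lift (h : X.Conf i p) {T : E} (f : T ⟶ B) (hf : f ≫ p = 0) :
    ∃ g : T ⟶ A, g ≫ i = f := by
  obtain ⟨w, h⟩ := h
  obtain ⟨l⟩ := X.isKernel _ h
  exact ⟨_, (KernelFork.IsLimit.lift' l f hf).2⟩

lemma exists_desc (h : X.Conf i p) {T : E} (f : B ⟶ T) (hf : i ≫ f = 0) :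
    ∃ g : C ⟶ T, p ≫ g = f := by
  obtain ⟨w, h⟩ := h
  obtain ⟨l⟩ := X.isCokernel _ h
  exact ⟨_, (CokernelCofork.IsColimit.desc' l f hf).2⟩

lemma mono (h : X.Conf i p) : Mono i := by
  obtain ⟨w, h⟩ := h
  obtain ⟨l⟩ := X.isKernel _ h
  exact mono_of_isLimit_fork l

lemma epi (h : X.Conf i p) : Epi p := by
  obtain ⟨w, h⟩ := h
  obtain ⟨l⟩ := X.isCokernel _ h
  exact epi_of_isColimit_cofork l

lemma of_iso (h : X.Conf i p) {A' B' C' : E} {i' : A' ⟶ B'} {p' : B' ⟶ C'}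
    (a : A ≅ A') (b : B ≅ B') (c : C ≅ C') (hi : i ≫ b.hom = a.hom ≫ i')
    (hp : p ≫ c.hom = b.hom ≫ p') : X.Conf i' p' := by
  obtain ⟨w, h⟩ := h
  have w' : i' ≫ p' = 0 := by
    rw [← cancel_epi a.hom, ← Category.assoc, ← hi, Category.assoc, ← hp, reassoc_of% w]
    simp
  have := X.isClosedUnderIsomorphisms
  exact ⟨w', X.conflation.prop_of_iso (ShortComplex.isoMk a b c hi.symm hp.symm) h⟩

lemma of_cokernel (h : X.Conf i p) {C' : E} (p' : B ⟶ C') (w : i ≫ p' = 0) (hp' : Epi p')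
    (hd : ∀ ⦃T : E⦄ (f : B ⟶ T), i ≫ f = 0 → ∃ g, p' ≫ g = f) : X.Conf i p' := by
  obtain ⟨c, hc⟩ := h.exists_desc p' w
  obtain ⟨d, hd⟩ := hd p h.zero
  have := h.epi
  refine h.of_iso (Iso.refl _) (Iso.refl _) ⟨c, d, ?_, ?_⟩ (by simp) (by simpa using hc)
  · rw [← cancel_epi p, reassoc_of% hc, hd, Category.comp_id]
  · rw [← cancel_epi p', reassoc_of% hd, hc, Category.comp_id]

lemma of_kernel (h : X.Conf i p) {A' : E} (i' : A' ⟶ B) (w : i' ≫ p = 0) (hi' : Mono i')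
    (hd : ∀ ⦃T : E⦄ (f : T ⟶ B), f ≫ p = 0 → ∃ g, g ≫ i' = f) : X.Conf i' p := by
  obtain ⟨c, hc⟩ := h.exists_lift i' w
  obtain ⟨d, hd⟩ := hd i h.zero
  have := h.mono
  refine h.of_iso ⟨d, c, ?_, ?_⟩ (Iso.refl _) (Iso.refl _) (by simpa using hd.symm) (by simp)
  · rw [← cancel_mono i, Category.assoc, hc, hd, Category.id_comp]
  · rw [← cancel_mono i', Category.assoc, hd, hc, Category.id_comp]

/-- The cokernel of an inflation is unique up to isomorphism. -/
lemma cokernel_iso (h : X.Conf i p) {C' : E} {p' : B ⟶ C'} (h' : X.Conf i p') :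
    ∃ e : C ≅ C', p ≫ e.hom = p' := by
  obtain ⟨c, hc⟩ := h.exists_desc p' h'.zero
  obtain ⟨d, hd⟩ := h'.exists_desc p h.zero
  have := h.epi
  have := h'.epi
  refine ⟨⟨c, d, ?_, ?_⟩, hc⟩
  · rw [← cancel_epi p, reassoc_of% hc, hd, Category.comp_id]
  · rw [← cancel_epi p', reassoc_of% hd, hc, Category.comp_id]

/-- The kernel of a deflation is unique up to isomorphism. -/
lemma kernel_iso (h : X.Conf i p) {A' : E} {i' : A' ⟶ B} (h' : X.Conf i' p) :
    Nonempty (A ≅ A') := by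
  obtain ⟨c, hc⟩ := h.exists_lift i' h'.zero
  obtain ⟨d, hd⟩ := h'.exists_lift i h.zero
  have := h.mono
  have := h'.mono
  refine ⟨⟨d, c, ?_, ?_⟩⟩
  · rw [← cancel_mono i, Category.assoc, hc, hd, Category.id_comp]
  · rw [← cancel_mono i', Category.assoc, hd, hc, Category.id_comp]

end Conf

lemma infl_iff {S : ObjectProperty E} {A B : E} {i : A ⟶ B} :
    X.Infl S i ↔ ∃ (C : E) (p : B ⟶ C), X.Conf i p ∧ S C :=
  ⟨fun ⟨C, p, w, h, hC⟩ => ⟨C, p, ⟨w, h⟩, hC⟩, fun ⟨C, p, ⟨w, h⟩, hC⟩ => ⟨C, p, w, h, hC⟩⟩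

lemma defl_iff {S : ObjectProperty E} {B C : E} {p : B ⟶ C} :
    X.Defl S p ↔ ∃ (A : E) (i : A ⟶ B), X.Conf i p ∧ S A :=
  ⟨fun ⟨C, p, w, h, hC⟩ => ⟨C, p, ⟨w, h⟩, hC⟩, fun ⟨C, p, ⟨w, h⟩, hC⟩ => ⟨C, p, w, h, hC⟩⟩

lemma Conf.infl {S : ObjectProperty E} {A B C : E} {i : A ⟶ B} {p : B ⟶ C} (h : X.Conf i p)
    (hC : S C) : X.Infl S i := infl_iff.2 ⟨C, p, h, hC⟩

lemma Conf.defl {S : ObjectProperty E} {A B C : E} {i : A ⟶ B} {p : B ⟶ C} (h : X.Conf i p)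
    (hA : S A) : X.Defl S p := defl_iff.2 ⟨A, i, h, hA⟩

lemma infl_top_iff {A B : E} {i : A ⟶ B} :
    firstMaps X.conflation ⊤ i ↔ ∃ (C : E) (p : B ⟶ C), X.Conf i p :=
  infl_iff.trans (by simp)

lemma defl_top_iff {B C : E} {p : B ⟶ C} :
    secondMaps X.conflation ⊤ p ↔ ∃ (A : E) (i : A ⟶ B), X.Conf i p :=
  defl_iff.trans (by simp)

/-- The opposite exact structure. -/
def op (X : ExactStructure E) : ExactStructure Eᵒᵖ where
  conflation := opConflation X.conflation
  isClosedUnderIsomorphisms := by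
    have := X.isClosedUnderIsomorphisms
    refine ⟨fun {S T} e h => X.conflation.prop_of_iso (?_ : S.unop ≅ T.unop) h⟩
    exact ⟨ShortComplex.unopMap e.inv, ShortComplex.unopMap e.hom,
      congrArg ShortComplex.unopMap e.hom_inv_id, congrArg ShortComplex.unopMap e.inv_hom_id⟩
  isKernel S h := (X.isCokernel _ h).map fun l => CokernelCofork.IsColimit.ofπOp _ S.unop.zero l
  isCokernel S h := (X.isKernel _ h).map fun l => KernelFork.IsLimit.ofιOp _ S.unop.zero l
  inflation_id A := (firstMaps_op_iff _ _).2 (X.deflation_id A.unop)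
  deflation_id A := (secondMaps_op_iff _ _).2 (X.inflation_id A.unop)
  inflation_comp f g hf hg := (firstMaps_op_iff _ _).2
    (X.deflation_comp _ _ ((firstMaps_op_iff _ _).1 hg) ((firstMaps_op_iff _ _).1 hf))
  deflation_comp f g hf hg := (secondMaps_op_iff _ _).2
    (X.inflation_comp _ _ ((secondMaps_op_iff _ _).1 hg) ((secondMaps_op_iff _ _).1 hf))
  inflation_pushout i f hi := by
    obtain ⟨Y, g, p, h, hp⟩ := X.deflation_pullback i.unop f.unop ((firstMaps_op_iff _ _).1 hi)
    exact ⟨.op Y, g.op, p.op, h.op.flip, (firstMaps_op_iff _ _).2 hp⟩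
  deflation_pullback p g hp := by
    obtain ⟨Y, f, i, h, hi⟩ := X.inflation_pushout p.unop g.unop ((secondMaps_op_iff _ _).1 hp)
    exact ⟨.op Y, f.op, i.op, h.op.flip, (secondMaps_op_iff _ _).2 hi⟩

lemma Conf.op {A B C : E} {i : A ⟶ B} {p : B ⟶ C} (h : X.Conf i p) : X.op.Conf p.op i.op :=
  ⟨by rw [← op_comp, h.zero, op_zero], h.2⟩

lemma Conf.unop {A B C : Eᵒᵖ} {i : A ⟶ B} {p : B ⟶ C} (h : X.op.Conf i p) :
    X.Conf p.unop i.unop :=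
  ⟨by rw [← unop_comp, h.zero, unop_zero], h.2⟩

/-- The pushout of a conflation along a morphism from its first term. -/
lemma Conf.of_isPushout {A B C A' B' : E} {i : A ⟶ B} {p : B ⟶ C} (h : X.Conf i p)
    {f : A ⟶ A'} {f' : B ⟶ B'} {i' : A' ⟶ B'} (sq : IsPushout i f f' i') :
    X.Conf i' (sq.desc p 0 (by simp [h.zero])) := by
  obtain ⟨B'', f'', i'', sq', hi⟩ := X.inflation_pushout i f (infl_top_iff.2 ⟨_, _, h⟩)
  obtain ⟨C', p', h'⟩ := infl_top_iff.1 hi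
  have h1 : X.Conf i' ((sq'.isoIsPushout _ _ sq).inv ≫ p') :=
    h'.of_iso (Iso.refl _) (sq'.isoIsPushout _ _ sq) (Iso.refl _) (by simp) (by simp)
  refine h1.of_cokernel _ (by simp) ⟨fun {T} a b hab => ?_⟩ fun T a ha => ?_
  · have := h.epi
    have := f' ≫= hab
    simpa [cancel_epi] using this
  · obtain ⟨g, hg⟩ := h.exists_desc (f' ≫ a) (by rw [sq.w_assoc, ha, comp_zero])
    exact ⟨g, sq.hom_ext (by simpa using hg) (by simp [ha])⟩

/-- The pushout of a conflation along a morphism from its first term. -/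
lemma Conf.exists_pushout {A B C A' : E} {i : A ⟶ B} {p : B ⟶ C} (h : X.Conf i p) (f : A ⟶ A') :
    ∃ (B' : E) (f' : B ⟶ B') (i' : A' ⟶ B') (p' : B' ⟶ C),
      IsPushout i f f' i' ∧ X.Conf i' p' ∧ f' ≫ p' = p := by
  obtain ⟨B', f', i', sq, -⟩ := X.inflation_pushout i f (infl_top_iff.2 ⟨_, _, h⟩)
  exact ⟨B', f', i', _, sq, h.of_isPushout sq, sq.inl_desc _ _ _⟩

/-- The pullback of a conflation along a morphism to its third term. -/
lemma Conf.exists_pullback {A B C C' : E} {i : A ⟶ B} {p : B ⟶ C} (h : X.Conf i p) (g : C' ⟶ C) :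
    ∃ (B' : E) (g' : B' ⟶ B) (p' : B' ⟶ C') (i' : A ⟶ B'),
      IsPullback g' p' p g ∧ X.Conf i' p' ∧ i' ≫ g' = i := by
  obtain ⟨B', f', i', p', sq, h', w⟩ := h.op.exists_pushout g.op
  exact ⟨B'.unop, f'.unop, i'.unop, p'.unop, sq.unop.flip, h'.unop, congrArg Quiver.Hom.unop w⟩

/-- A deflation is stable under any pullback. -/
lemma Conf.of_isPullback {A B C B' C' : E} {i : A ⟶ B} {p : B ⟶ C} (h : X.Conf i p)
    {g' : B' ⟶ B} {p' : B' ⟶ C'} {g : C' ⟶ C} (sq : IsPullback g' p' p g) :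
    ∃ i' : A ⟶ B', X.Conf i' p' ∧ i' ≫ g' = i := by
  obtain ⟨B'', g'', p'', i'', sq', h', w⟩ := h.exists_pullback g
  exact ⟨i'' ≫ (sq'.isoIsPullback _ _ sq).hom,
    h'.of_iso (Iso.refl _) (sq'.isoIsPullback _ _ sq) (Iso.refl _) (by simp) (by simp),
    by simpa using w⟩

variable (X) in
lemma conf_zero_id (A : E) : X.Conf (0 : (0 : E) ⟶ A) (𝟙 A) := by
  obtain ⟨K, i, h⟩ := defl_top_iff.1 (X.deflation_id A)
  refine h.of_kernel _ (by simp) ⟨fun a b _ => (isZero_zero E).eq_of_tgt _ _⟩ fun T f hf => ⟨0, ?_⟩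
  simpa using hf.symm

variable (X) in
lemma conf_id_zero (A : E) : X.Conf (𝟙 A) (0 : A ⟶ (0 : E)) := by
  obtain ⟨K, i, h⟩ := infl_top_iff.1 (X.inflation_id A)
  refine h.of_cokernel _ (by simp) ⟨fun a b _ => (isZero_zero E).eq_of_src _ _⟩
    fun T f hf => ⟨0, ?_⟩
  simpa using hf.symm

-- The pushout of the conflation `0 ⟶ C ⟶ C` along `0 ⟶ A` is the biproduct sequence.
variable (X) in
lemma conf_of_split {A B C : E} (i : A ⟶ B) (p : B ⟶ C) (r : B ⟶ A) (s : C ⟶ B)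
    (hi : i ≫ r = 𝟙 A) (hp : s ≫ p = 𝟙 C) (w : i ≫ p = 0) (h : r ≫ i + p ≫ s = 𝟙 B) :
    X.Conf i p := by
  have hs : s ≫ r = 0 := by
    have : (s ≫ r) ≫ i = 0 := by
      have := s ≫= h
      simpa [reassoc_of% hp] using this
    simpa [hi] using this =≫ r
  have sq : IsPushout (0 : (0 : E) ⟶ C) (0 : (0 : E) ⟶ A) s i := by
    refine ⟨⟨by simp⟩, ⟨PushoutCocone.IsColimit.mk _ (fun c => r ≫ c.inr + p ≫ c.inl)
      (fun c => by simp [reassoc_of% hs, reassoc_of% hp])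
      (fun c => by simp [reassoc_of% hi, reassoc_of% w]) fun c m hl hr => ?_⟩⟩
    rw [← hl, ← hr, ← Category.assoc, ← Category.assoc, ← Preadditive.add_comp, h,
      Category.id_comp]
  have := (X.conf_zero_id C).of_isPushout sq
  have e : sq.desc (𝟙 C) 0 (by simp) = p := sq.hom_ext (by simp [hp]) (by simp [w])
  rwa [e] at this

lemma Conf.exists_comp {A B B' C C' : E} {i : A ⟶ B} {p : B ⟶ C} (h : X.Conf i p) {j : B ⟶ B'}
    {q : B' ⟶ C'} (h' : X.Conf j q) : ∃ (D : E) (r : B' ⟶ D), X.Conf (i ≫ j) r :=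
  infl_top_iff.1 (X.inflation_comp i j (infl_top_iff.2 ⟨_, _, h⟩) (infl_top_iff.2 ⟨_, _, h'⟩))

lemma Conf.map_id {A B C : E} {i : A ⟶ B} {p : B ⟶ C} (h : X.Conf i p) (D : E) :
    X.Conf (biprod.map (𝟙 D) i) (biprod.snd ≫ p) := by
  have sq : IsPushout i (biprod.inr : A ⟶ D ⊞ A) biprod.inr (biprod.map (𝟙 D) i) := by
    refine ⟨⟨by simp⟩, ⟨PushoutCocone.IsColimit.mk _
      (fun c => biprod.desc (biprod.inl ≫ c.inr) c.inl) (fun c => by simp) (fun c => ?_)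
      fun c m hl hr => ?_⟩⟩
    · ext <;> simp [c.condition]
    · ext <;> simp [← hl, ← hr]
  have := h.of_isPushout sq
  have e : sq.desc p 0 (by simp [h.zero]) = biprod.snd ≫ p :=
    sq.hom_ext (by simp) (by simp [h.zero])
  rwa [e] at this

/-- If `j` is an inflation, so is `(f, j)`. -/
lemma Conf.exists_lift_conf {A B C D : E} {j : A ⟶ B} {p : B ⟶ C} (h : X.Conf j p) (f : A ⟶ D) :
    ∃ (C' : E) (q : D ⊞ B ⟶ C'), X.Conf (biprod.lift f j) q := by
  -- `(f, j)` is the graph `(f, 1)`, a split inflation, followed by `1 ⊕ j`.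
  have h1 : X.Conf (biprod.lift f (𝟙 A)) (biprod.desc (𝟙 D) (-f)) :=
    X.conf_of_split _ _ biprod.snd biprod.inl (by simp) (by simp) (by simp) (by
      ext <;> simp)
  have e : biprod.lift f (𝟙 A) ≫ biprod.map (𝟙 D) j = biprod.lift f j := by ext <;> simp
  exact e ▸ h1.exists_comp (h.map_id D)

/-- The conflation `A ⟶ D ⊞ B ⟶ P` attached to a pushout of an inflation. -/
lemma Conf.lift_of_isPushout {A B C D P : E} {j : A ⟶ B} {p : B ⟶ C} (h : X.Conf j p)
    {f : A ⟶ D} {f' : B ⟶ P} {j' : D ⟶ P} (sq : IsPushout j f f' j') :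
    X.Conf (biprod.lift f j) (biprod.desc j' (-f')) := by
  obtain ⟨C', q, h'⟩ := h.exists_lift_conf f
  refine h'.of_cokernel _ (by simp [sq.w]) ⟨fun a b hab => ?_⟩ fun T g hg => ?_
  · have h1 := biprod.inl ≫= hab
    have h2 := biprod.inr ≫= hab
    simp only [biprod.inl_desc_assoc, biprod.inr_desc_assoc, Preadditive.neg_comp,
      neg_inj] at h1 h2
    exact sq.hom_ext h2 h1
  · have : f ≫ biprod.inl ≫ g + j ≫ biprod.inr ≫ g = 0 := by
      rw [← hg, biprod.lift_eq]; simp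
    refine ⟨sq.desc (-(biprod.inr ≫ g)) (biprod.inl ≫ g) ?_, ?_⟩
    · rw [Preadditive.comp_neg, ← sub_eq_zero, ← neg_eq_zero, ← this]; abel
    · ext <;> simp

/-- A section of a deflation is an inflation whose cokernel is the kernel of the deflation. -/
lemma Conf.of_section {K A B : E} {k : K ⟶ B} {p : B ⟶ A} (h : X.Conf k p) {s : A ⟶ B}
    (hs : s ≫ p = 𝟙 A) : ∃ r : B ⟶ K, X.Conf s r ∧ k ≫ r = 𝟙 K := by
  obtain ⟨r, hr⟩ := h.exists_lift (𝟙 B - p ≫ s) (by simp [hs])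
  have := h.mono
  have hk : k ≫ r = 𝟙 K := by
    rw [← cancel_mono k, Category.assoc, hr]; simp [reassoc_of% h.zero]
  exact ⟨r, X.conf_of_split _ _ p k hs hk (by
    rw [← cancel_mono k, Category.assoc, hr]; simp [reassoc_of% hs]) (by simp [hr]), hk⟩

/-- Noether's isomorphism: the cokernels in a composition of inflations form a conflation. -/
lemma Conf.comp {A B B' C D : E} {f : A ⟶ B} {p : B ⟶ C} (h : X.Conf f p) {g : B ⟶ B'}
    {q : B' ⟶ D} (h' : X.Conf g q) :
    ∃ (M : E) (π : B' ⟶ M) (a : C ⟶ M) (b : M ⟶ D),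
      X.Conf (f ≫ g) π ∧ X.Conf a b ∧ IsPushout g p π a ∧ π ≫ b = q := by
  obtain ⟨M, π, a, b, sq, hab, w⟩ := h'.exists_pushout p
  obtain ⟨_, _, h''⟩ := h.exists_comp h'
  refine ⟨M, π, a, b, ?_, hab, sq, w⟩
  have := h.epi
  refine h''.of_cokernel _ (by simp [sq.w, reassoc_of% h.zero]) ⟨fun x y hxy => ?_⟩ fun T x hx => ?_
  · refine sq.hom_ext hxy ?_
    rw [← cancel_epi p, ← sq.w_assoc, ← sq.w_assoc, hxy]
  · obtain ⟨y, hy⟩ := h.exists_desc (g ≫ x) (by simpa using hx)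
    exact ⟨sq.desc x y hy.symm, by simp⟩

/-- The kernels in a composition of deflations form a conflation. -/
lemma Conf.comp' {K L A B C : E} {i : K ⟶ A} {p : A ⟶ B} (h : X.Conf i p) {j : L ⟶ B}
    {q : B ⟶ C} (h' : X.Conf j q) :
    ∃ (M : E) (m : M ⟶ A) (a : K ⟶ M) (b : M ⟶ L),
      X.Conf m (p ≫ q) ∧ X.Conf a b ∧ a ≫ m = i ∧ m ≫ p = b ≫ j := by
  obtain ⟨M, m, b, a, hm, hab, sq, w⟩ := h'.op.comp h.op
  exact ⟨M.unop, m.unop, a.unop, b.unop, hm.unop, hab.unop, congrArg Quiver.Hom.unop w,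
    congrArg Quiver.Hom.unop sq.w⟩

/-- If `f ≫ g` is an inflation and `g` is a deflation, then `f` is an inflation, and
`Ker g ⟶ Coker f ⟶ Coker (f ≫ g)` is a conflation. -/
lemma Conf.of_comp_deflation {K A B B' D : E} {f : A ⟶ B} {g : B ⟶ B'} {k : K ⟶ B} {q : B' ⟶ D}
    (hg : X.Conf k g) (h : X.Conf (f ≫ g) q) :
    ∃ (C : E) (c : B ⟶ C) (b : C ⟶ D), X.Conf f c ∧ X.Conf (k ≫ c) b ∧ c ≫ b = g ≫ q := by
  obtain ⟨M, m, a, b, hm, hab, ham, hmg⟩ := hg.comp' h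
  -- `f` factors through `m = Ker (g ≫ q)` by a section `s` of the deflation `b : M ⟶ A`. The
  -- cokernel of `s` is `Ker b = K`, so `f = s ≫ m` is a composite of inflations, and Noether's
  -- isomorphism gives the conflation.
  obtain ⟨s, hs⟩ := hm.exists_lift f (by simpa using h.zero)
  have := h.mono
  have hsb : s ≫ b = 𝟙 A := by
    rw [← cancel_mono (f ≫ g), Category.assoc, ← hmg, reassoc_of% hs, Category.id_comp]
  obtain ⟨r, hr, har⟩ := hab.of_section hsb
  obtain ⟨C, c, a', b', hc, hab', sq, w⟩ := hr.comp hm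
  rw [hs] at hc
  have e : k ≫ c = a' := by rw [← ham, Category.assoc, sq.w, reassoc_of% har]
  exact ⟨C, c, b', hc, e ▸ hab', w⟩

/-- If `f ≫ g` is a deflation and `f` is an inflation, then `g` is a deflation, and
`Ker (f ≫ g) ⟶ Ker g ⟶ Coker f` is a conflation. -/
lemma Conf.of_inflation_comp {K A B B' D : E} {f : A ⟶ B} {g : B ⟶ B'} {q : B ⟶ D} {k : K ⟶ A}
    (hf : X.Conf f q) (h : X.Conf k (f ≫ g)) :
    ∃ (C : E) (c : C ⟶ B) (b : K ⟶ C), X.Conf c g ∧ X.Conf b (c ≫ q) ∧ b ≫ c = k ≫ f := by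
  obtain ⟨C, c, b, hc, hb, w⟩ := Conf.of_comp_deflation (f := g.op) hf.op h.op
  exact ⟨C.unop, c.unop, b.unop, hc.unop, hb.unop, congrArg Quiver.Hom.unop w⟩

end Conflations

/-! ### Cancellation of inflations and deflations -/

section WeaklyIdempotentComplete

variable {E : Type u} [Category.{v} E] [Preadditive E]

/-- The cokernel projection `π` of a section is itself split, and its splitting `σ` is a kernel of
the corresponding retraction. -/
lemma _root_.WeaklyIdempotentComplete.op (hE : WeaklyIdempotentComplete E) :
    WeaklyIdempotentComplete Eᵒᵖ := by
  rintro A B s ⟨⟨⟨r, hr⟩⟩⟩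
  have hr' : r.unop ≫ s.unop = 𝟙 _ := congrArg Quiver.Hom.unop hr
  have := hE r.unop ⟨⟨⟨s.unop, hr'⟩⟩⟩
  let π := cokernel.π r.unop
  let σ := cokernel.desc r.unop (𝟙 _ - s.unop ≫ r.unop) (by simp [reassoc_of% hr'])
  have hσ : π ≫ σ = 𝟙 _ - s.unop ≫ r.unop := cokernel.π_desc _ _ _
  have w : σ ≫ s.unop = 0 := by
    rw [← cancel_epi π, reassoc_of% hσ]; simp [hr']
  have hσπ : σ ≫ π = 𝟙 _ := by
    rw [← cancel_epi π, reassoc_of% hσ]; simp [π]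
  refine ⟨⟨⟨_, KernelFork.IsLimit.ofιOp σ w (KernelFork.IsLimit.ofι _ _ (fun x _ => x ≫ π)
    (fun x hx => ?_) fun x hx m hm => ?_)⟩⟩⟩
  · rw [Category.assoc, hσ]; simp [reassoc_of% hx]
  · rw [← hm, Category.assoc, hσπ, Category.comp_id]

variable [HasZeroObject E] [HasBinaryBiproducts E] {X : ExactStructure E}

/-- In a weakly idempotent complete exact category, `f` is an inflation if `f ≫ g` is. -/
lemma Conf.of_comp (hE : WeaklyIdempotentComplete E) {A B C D : E} {f : A ⟶ B} {g : B ⟶ C}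
    {q : C ⟶ D} (h : X.Conf (f ≫ g) q) : ∃ (K : E) (p : B ⟶ K), X.Conf f p := by
  obtain ⟨_, _, h1⟩ := h.exists_lift_conf f
  -- The shear `(b, c) ↦ (b, c - g b)` is an automorphism, recorded as an inflation with zero
  -- cokernel. It turns the inflation `(f, f ≫ g)` into `(f, 0)`.
  have h2 : X.Conf (biprod.lift (biprod.fst : B ⊞ C ⟶ B) (biprod.snd - biprod.fst ≫ g))
      (0 : _ ⟶ (0 : E)) :=
    X.conf_of_split _ _ (biprod.lift biprod.fst (biprod.snd + biprod.fst ≫ g)) 0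
      (by ext <;> simp) ((isZero_zero E).eq_of_src _ _) (by simp) (by ext <;> simp)
  obtain ⟨Q, q, h3⟩ := h1.exists_comp h2
  have e : biprod.lift f (f ≫ g) ≫ biprod.lift biprod.fst (biprod.snd - biprod.fst ≫ g) =
      biprod.lift f 0 := by ext <;> simp
  rw [e] at h3
  -- `C` is a retract of `Q`; weak idempotent completeness provides the complementary summand, with
  -- projection `π` and inclusion `σ`.
  obtain ⟨t, ht⟩ := h3.exists_desc biprod.snd (by simp)
  have ht' : (biprod.inr ≫ q) ≫ t = 𝟙 C := by simp [ht]
  have := hE (biprod.inr ≫ q) ⟨⟨⟨t, ht'⟩⟩⟩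
  let π := cokernel.π (biprod.inr ≫ q)
  have hπ : biprod.inr ≫ q ≫ π = 0 := by
    rw [← Category.assoc]; exact cokernel.condition (biprod.inr ≫ q)
  let σ : cokernel (biprod.inr ≫ q) ⟶ Q := cokernel.desc _ (𝟙 Q - t ≫ biprod.inr ≫ q) (by
    simp only [Category.assoc] at ht'
    simp [reassoc_of% ht'])
  have hσ : π ≫ σ = 𝟙 Q - t ≫ biprod.inr ≫ q := cokernel.π_desc _ _ _
  have hσπ : σ ≫ π = 𝟙 _ := by
    rw [← cancel_epi π, reassoc_of% hσ]; simp [hπ]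
  have hσt : σ ≫ t = 0 := by
    simp only [Category.assoc] at ht'
    rw [← cancel_epi π, reassoc_of% hσ]; simp [ht']
  -- Restricting `q` over the complement of `C` leaves `B`. Hence `inl ≫ q ≫ π` is a deflation, and
  -- its kernel turns out to be `f`.
  have sq : IsPullback biprod.inl (biprod.inl ≫ q ≫ π) q σ := by
    have w : biprod.inl ≫ q = (biprod.inl ≫ q ≫ π) ≫ σ := by
      simp [hσ, reassoc_of% ht]
    refine ⟨⟨w⟩, ⟨PullbackCone.IsLimit.mk _ (fun c => c.fst ≫ biprod.fst) (fun c => ?_)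
      (fun c => ?_) fun c m hl hr => by simp [← hl]⟩⟩
    all_goals
      have h0 : c.fst ≫ biprod.snd = 0 := by rw [← ht, c.condition_assoc, hσt, comp_zero]
      have h1 : c.fst ≫ biprod.fst ≫ biprod.inl = c.fst := by
        rw [← sub_eq_zero, ← neg_eq_zero, neg_sub]
        ext <;> simp [h0]
    · simpa using h1
    · simp only [Category.assoc, reassoc_of% h1]
      rw [c.condition_assoc, hσπ, Category.comp_id]
  obtain ⟨i', hi', -⟩ := h3.of_isPullback sq
  have hσ' : ∀ {T : E} (x : T ⟶ B), x ≫ biprod.inl ≫ q ≫ π = 0 → x ≫ biprod.inl ≫ q = 0 := by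
    intro T x hx
    have := hx =≫ σ
    simpa [hσ, reassoc_of% ht] using this
  have := h.mono
  refine ⟨_, _, hi'.of_kernel f ?_ (mono_of_mono f g) fun T x hx => ?_⟩
  · have := h3.zero
    rw [biprod.lift_eq] at this
    simp only [zero_comp, add_zero, Category.assoc] at this
    simp [reassoc_of% this]
  · obtain ⟨y, hy⟩ := h3.exists_lift (x ≫ biprod.inl) (by simpa using hσ' x hx)
    exact ⟨y, by simpa using hy =≫ biprod.fst⟩

/-- In a weakly idempotent complete exact category, `g` is a deflation if `f ≫ g` is. -/
lemma Conf.of_comp' (hE : WeaklyIdempotentComplete E) {A B C K : E} {f : A ⟶ B} {g : B ⟶ C}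
    {k : K ⟶ A} (h : X.Conf k (f ≫ g)) : ∃ (L : E) (l : L ⟶ B), X.Conf l g := by
  obtain ⟨K, p, h⟩ := Conf.of_comp hE.op (f := g.op) h.op
  exact ⟨_, _, h.unop⟩

end WeaklyIdempotentComplete
end ExactStructure

namespace ExactStructure

/-! ### Vanishing of Ext, lifting, and cotorsion pairs -/

section Orthogonality

variable {E : Type u} [Category.{v} E] [Preadditive E] [HasZeroObject E] [HasBinaryBiproducts E]

/-- Every conflation `B ⟶ M ⟶ A` splits. -/
def Orth (X : ExactStructure E) (A B : E) : Prop :=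
  ∀ ⦃M : E⦄ (i : B ⟶ M) (p : M ⟶ A), X.Conf i p → ∃ s : A ⟶ M, s ≫ p = 𝟙 A

variable {X : ExactStructure E}

lemma Conf.exists_section {A B M : E} {i : B ⟶ M} {p : M ⟶ A} (h : X.Conf i p) {r : M ⟶ B}
    (hr : i ≫ r = 𝟙 B) : ∃ s : A ⟶ M, s ≫ p = 𝟙 A := by
  obtain ⟨s, hs⟩ := h.exists_desc (𝟙 M - r ≫ i) (by simp [reassoc_of% hr])
  have := h.epi
  exact ⟨s, by rw [← cancel_epi p, reassoc_of% hs]; simp [h.zero]⟩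

/-- Being split is invariant under the generating relation in both directions: sections push
forward, retractions pull back. Conversely, a split extension maps to the biproduct extension. -/
lemma subsingleton_yonedaExt_iff {A B : E} : Subsingleton (X.YonedaExt A B) ↔ X.Orth A B := by
  obtain ⟨w, hs⟩ : X.Conf (biprod.inl : B ⟶ B ⊞ A) biprod.snd :=
    X.conf_of_split _ _ biprod.fst biprod.inr (by simp) (by simp) (by simp) biprod.total
  let ε₀ : X.Extension A B := ⟨_, _, _, w, hs⟩
  constructor
  · intro hsub M i p ⟨w, h⟩
    let ε : X.Extension A B := ⟨M, i, p, w, h⟩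
    have key : ∀ ε₁ ε₂ : X.Extension A B,
        Relation.EqvGen (fun ε ε' : X.Extension A B =>
          ∃ h : ε.M ⟶ ε'.M, ε.i ≫ h = ε'.i ∧ h ≫ ε'.p = ε.p) ε₁ ε₂ →
        ((∃ s, s ≫ ε₁.p = 𝟙 A) ↔ ∃ s, s ≫ ε₂.p = 𝟙 A) := by
      intro ε₁ ε₂ h
      induction h with
      | rel ε₁ ε₂ h =>
        obtain ⟨f, hi, hp⟩ := h
        refine ⟨fun ⟨s, hs⟩ => ⟨s ≫ f, by rw [Category.assoc, hp, hs]⟩, fun ⟨s, hs⟩ => ?_⟩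
        have h₁ : X.Conf ε₁.i ε₁.p := ⟨_, ε₁.conflation⟩
        have h₂ : X.Conf ε₂.i ε₂.p := ⟨_, ε₂.conflation⟩
        obtain ⟨r, -, hr⟩ := h₂.of_section hs
        exact h₁.exists_section (r := f ≫ r) (by rw [reassoc_of% hi, hr])
      | refl => rfl
      | symm _ _ _ h => exact h.symm
      | trans _ _ _ _ _ h h' => exact h.trans h'
    exact (key ε ε₀ (Quot.eqvGen_exact (hsub.elim (Quot.mk _ ε) (Quot.mk _ ε₀)))).2
      ⟨biprod.inr, biprod.inr_snd⟩
  · intro h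
    have key : ∀ ε : X.Extension A B, (Quot.mk _ ε : X.YonedaExt A B) = Quot.mk _ ε₀ := by
      intro ε
      have hε : X.Conf ε.i ε.p := ⟨_, ε.conflation⟩
      obtain ⟨s, hs⟩ := h _ _ hε
      obtain ⟨r, -, hr⟩ := hε.of_section hs
      refine Quot.sound ⟨biprod.lift r ε.p, ?_, biprod.lift_snd _ _⟩
      change ε.i ≫ biprod.lift r ε.p = biprod.inl
      ext <;> simp [hr, ε.zero]
    refine ⟨fun a b => ?_⟩
    induction a using Quot.ind with | mk a =>
    induction b using Quot.ind with | mk b =>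
    rw [key a, key b]

lemma leftPerp_iff {S : ObjectProperty E} {A : E} :
    X.leftPerp S A ↔ ∀ B, S B → X.Orth A B :=
  forall₂_congr fun _ _ => subsingleton_yonedaExt_iff

lemma rightPerp_iff {S : ObjectProperty E} {B : E} :
    X.rightPerp S B ↔ ∀ A, S A → X.Orth A B :=
  forall₂_congr fun _ _ => subsingleton_yonedaExt_iff

lemma Orth.exists_lift {A B Y Z : E} (h : X.Orth A B) {k : B ⟶ Y} {q : Y ⟶ Z} (hq : X.Conf k q)
    (v : A ⟶ Z) : ∃ t : A ⟶ Y, t ≫ q = v := by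
  obtain ⟨P, g, p, i, sq, hp, -⟩ := hq.exists_pullback v
  obtain ⟨s, hs⟩ := h _ _ hp
  exact ⟨s ≫ g, by rw [Category.assoc, sq.w, reassoc_of% hs]⟩

lemma Orth.exists_extension {A B Y Z : E} (h : X.Orth A B) {i : Y ⟶ Z} {c : Z ⟶ A}
    (hi : X.Conf i c) (u : Y ⟶ B) : ∃ t : Z ⟶ B, i ≫ t = u := by
  obtain ⟨P, g, j, p, sq, hp, -⟩ := hi.exists_pushout u
  obtain ⟨s, hs⟩ := h _ _ hp
  obtain ⟨r, -, hr⟩ := hp.of_section hs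
  exact ⟨g ≫ r, by rw [sq.w_assoc, hr, Category.comp_id]⟩

/-- If `Ext¹(A, B) = 0`, inflations with cokernel `A` have the left lifting property with respect
to deflations with kernel `B`. -/
lemma Orth.hasLiftingProperty {A B Y Y' Z Z' : E} (h : X.Orth A B) {i : Y ⟶ Y'} {c : Y' ⟶ A}
    (hi : X.Conf i c) {k : B ⟶ Z} {p : Z ⟶ Z'} (hp : X.Conf k p) : HasLiftingProperty i p := by
  refine ⟨fun {u v} sq => ?_⟩
  -- First solve the lower triangle alone. Over the pullback of `p` along `v`, the map `s` is an
  -- inflation whose cokernel extends `A` by `B`. Splitting that extension gives a retraction of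
  -- `k'`, hence a section of `p'`.
  have hv : ∃ t : Y' ⟶ Z, t ≫ p = v := by
    obtain ⟨P, g, p', k', sq', hp', hk⟩ := hp.exists_pullback v
    let s := sq'.lift u i sq.w
    have hs : s ≫ p' = i := sq'.lift_snd _ _ _
    obtain ⟨M, m, b, -, hb, -⟩ := hp'.of_comp_deflation (hs.symm ▸ hi)
    obtain ⟨σ, hσ⟩ := h _ _ hb
    obtain ⟨r, -, hr⟩ := hb.of_section hσ
    obtain ⟨τ, hτ⟩ := hp'.exists_section (r := m ≫ r) (by rwa [← Category.assoc])
    exact ⟨τ ≫ g, by rw [Category.assoc, sq'.w, reassoc_of% hτ]⟩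
  obtain ⟨t, ht⟩ := hv
  -- The error in the upper triangle lands in `Ker p = B`; its extension along `i` corrects `t`
  -- without changing `t ≫ p`.
  obtain ⟨b, hb⟩ := hp.exists_lift (u - i ≫ t) (by simp [ht, sq.w])
  obtain ⟨b', hb'⟩ := h.exists_extension hi b
  exact ⟨⟨⟨t + b' ≫ k, by simp [reassoc_of% hb', hb], by simp [ht, hp.zero]⟩⟩⟩

lemma Orth.of_extension {A₁ A₂ A₃ B : E} {i : A₁ ⟶ A₂} {p : A₂ ⟶ A₃} (h : X.Conf i p)
    (h₁ : X.Orth A₁ B) (h₃ : X.Orth A₃ B) : X.Orth A₂ B := by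
  intro M k q hq
  obtain ⟨t, ht⟩ := h₁.exists_lift hq i
  have := h₃.hasLiftingProperty h hq
  have sq : CommSq t i q (𝟙 A₂) := ⟨by simpa using ht⟩
  exact ⟨sq.lift, sq.fac_right⟩

lemma Orth.of_iso_left {A A' B : E} (h : X.Orth A B) (e : A ≅ A') : X.Orth A' B := by
  intro M k q hq
  obtain ⟨t, ht⟩ := h.exists_lift hq e.hom
  exact ⟨e.inv ≫ t, by simp [ht]⟩

lemma Orth.of_iso_right {A B B' : E} (h : X.Orth A B) (e : B ≅ B') : X.Orth A B' := by
  intro M k q hq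
  exact h (e.hom ≫ k) q (hq.of_iso e.symm (Iso.refl _) (Iso.refl _) (by simp) (by simp))

lemma infl_zero_iff {S : ObjectProperty E} [S.IsClosedUnderIsomorphisms] {A : E} :
    X.Infl S (0 : (0 : E) ⟶ A) ↔ S A := by
  refine ⟨fun h => ?_, fun h => (X.conf_zero_id A).infl h⟩
  obtain ⟨C, p, hp, hC⟩ := infl_iff.1 h
  obtain ⟨e, -⟩ := hp.cokernel_iso (X.conf_zero_id A)
  exact S.prop_of_iso e hC

lemma defl_zero_iff {S : ObjectProperty E} [S.IsClosedUnderIsomorphisms] {A : E} :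
    X.Defl S (0 : A ⟶ (0 : E)) ↔ S A := by
  refine ⟨fun h => ?_, fun h => (X.conf_id_zero A).defl h⟩
  obtain ⟨C, p, hp, hC⟩ := defl_iff.1 h
  obtain ⟨e⟩ := hp.kernel_iso (X.conf_id_zero A)
  exact S.prop_of_iso e hC

lemma Conf.infl_iff {S : ObjectProperty E} [S.IsClosedUnderIsomorphisms] {A B C : E} {i : A ⟶ B}
    {p : B ⟶ C} (h : X.Conf i p) : X.Infl S i ↔ S C := by
  refine ⟨fun h' => ?_, h.infl⟩
  obtain ⟨C, p, hp, hC⟩ := ExactStructure.infl_iff.1 h'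
  obtain ⟨e, -⟩ := hp.cokernel_iso h
  exact S.prop_of_iso e hC

lemma Conf.defl_iff {S : ObjectProperty E} [S.IsClosedUnderIsomorphisms] {A B C : E} {i : A ⟶ B}
    {p : B ⟶ C} (h : X.Conf i p) : X.Defl S p ↔ S A := by
  refine ⟨fun h' => ?_, h.defl⟩
  obtain ⟨C, p, hp, hC⟩ := ExactStructure.defl_iff.1 h'
  obtain ⟨e⟩ := hp.kernel_iso h
  exact S.prop_of_iso e hC

lemma infl_inf_iff {S T : ObjectProperty E} [S.IsClosedUnderIsomorphisms] {A B : E} {f : A ⟶ B} :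
    X.Infl (S ⊓ T) f ↔ X.Infl S f ∧ X.Infl T f := by
  refine ⟨fun h => ?_, fun ⟨h, h'⟩ => ?_⟩
  · obtain ⟨C, p, hp, hC, hC'⟩ := infl_iff.1 h
    exact ⟨hp.infl hC, hp.infl hC'⟩
  · obtain ⟨C, p, hp, hC⟩ := infl_iff.1 h'
    exact hp.infl ⟨hp.infl_iff.1 h, hC⟩

lemma defl_inf_iff {S T : ObjectProperty E} [S.IsClosedUnderIsomorphisms] {A B : E} {f : A ⟶ B} :
    X.Defl (S ⊓ T) f ↔ X.Defl S f ∧ X.Defl T f := by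
  refine ⟨fun h => ?_, fun ⟨h, h'⟩ => ?_⟩
  · obtain ⟨C, p, hp, hC, hC'⟩ := defl_iff.1 h
    exact ⟨hp.defl hC, hp.defl hC'⟩
  · obtain ⟨C, p, hp, hC⟩ := defl_iff.1 h'
    exact hp.defl ⟨hp.defl_iff.1 h, hC⟩

namespace IsCompleteCotorsionPair

variable {A B : ObjectProperty E}

lemma left_iff (h : X.IsCompleteCotorsionPair A B) {Y : E} : A Y ↔ ∀ Z, B Z → X.Orth Y Z := by
  rw [← leftPerp_iff, ← h.left_eq]

lemma right_iff (h : X.IsCompleteCotorsionPair A B) {Y : E} : B Y ↔ ∀ Z, A Z → X.Orth Z Y := by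
  rw [← rightPerp_iff, h.right_eq]

lemma isClosedUnderIsomorphisms_left (h : X.IsCompleteCotorsionPair A B) :
    A.IsClosedUnderIsomorphisms :=
  ⟨fun e hY => h.left_iff.2 fun Z hZ => (h.left_iff.1 hY Z hZ).of_iso_left e⟩

lemma isClosedUnderIsomorphisms_right (h : X.IsCompleteCotorsionPair A B) :
    B.IsClosedUnderIsomorphisms :=
  ⟨fun e hY => h.right_iff.2 fun Z hZ => (h.right_iff.1 hY Z hZ).of_iso_right e⟩

/-- Add to `Y` an approximation `A₁ ⟶ Z` so that `(f, p₁) : Y ⊞ A₁ ⟶ Z` becomes a deflation, then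
push out along an embedding of its kernel into an object of `B`. The cokernel of `Y ⟶ V` is an
extension of `A₂` by `A₁`. -/
lemma exists_factorization (h : X.IsCompleteCotorsionPair A B) (hE : WeaklyIdempotentComplete E)
    {Y Z : E} (f : Y ⟶ Z) :
    ∃ (V : E) (i : Y ⟶ V) (p : V ⟶ Z), X.Infl A i ∧ X.Defl B p ∧ i ≫ p = f := by
  obtain ⟨B₁, A₁, i₁, p₁, w₁, h₁, -, hA₁⟩ := h.exists_right_approx Z
  replace h₁ : X.Conf i₁ p₁ := ⟨w₁, h₁⟩
  have h₂ : X.Conf i₁ (biprod.inr ≫ biprod.desc f p₁) := by simpa using h₁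
  obtain ⟨K, k, hk⟩ := h₂.of_comp' hE
  obtain ⟨B₂, A₂, i₂, p₂, w₂, hc, hB₂, hA₂⟩ := h.exists_left_approx K
  replace hc : X.Conf i₂ p₂ := ⟨w₂, hc⟩
  obtain ⟨V, g, j, q, sq, hq, hgq⟩ := hk.exists_pushout i₂
  have hg := hc.of_isPushout sq.flip
  have hinl : X.Conf (biprod.inl : Y ⟶ Y ⊞ A₁) biprod.snd :=
    X.conf_of_split _ _ biprod.fst biprod.inr (by simp) (by simp) (by simp) biprod.total
  obtain ⟨M, π, a, b, hπ, hab, -⟩ := hinl.comp hg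
  refine ⟨V, biprod.inl ≫ g, q, hπ.infl ?_, hq.defl hB₂, by simp [hgq]⟩
  exact h.left_iff.2 fun T hT =>
    .of_extension hab (h.left_iff.1 hA₁ T hT) (h.left_iff.1 hA₂ T hT)

/-- A complete cotorsion pair gives an exact weak factorization system. -/
lemma isExactWFS (h : X.IsCompleteCotorsionPair A B) (hE : WeaklyIdempotentComplete E) :
    X.IsExactWFS (X.Infl A) (X.Defl B) := by
  have := h.isClosedUnderIsomorphisms_left
  have := h.isClosedUnderIsomorphisms_right
  have lift : ∀ {Y Y' Z Z' : E} (i : Y ⟶ Y') (p : Z ⟶ Z'), X.Infl A i → X.Defl B p →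
      HasLiftingProperty i p := by
    intro Y Y' Z Z' i p hi hp
    obtain ⟨C, c, hc, hC⟩ := infl_iff.1 hi
    obtain ⟨K, k, hk, hK⟩ := defl_iff.1 hp
    exact (h.left_iff.1 hC K hK).hasLiftingProperty hc hk
  refine ⟨{ rlp := ?_, llp := ?_, hasFactorization := ⟨fun f => ?_⟩ }, fun f => ?_, fun f => ?_⟩
  · refine le_antisymm (fun Z W p hp => ?_) fun Z W p hp Y Y' i hi => lift i p hi hp
    obtain ⟨V, l, r, hl, hr, fac⟩ := h.exists_factorization hE p
    have := hp l hl
    -- The retract argument gives `r = sq.lift ≫ p`, which is used only to see that `p` is a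
    -- deflation. Its kernel is in `B` because lifting against `p` retracts every conflation from
    -- that kernel to an object of `A`.
    have sq : CommSq (𝟙 Z) l p r := ⟨by simp [fac]⟩
    obtain ⟨K, k, hk, -⟩ := defl_iff.1 hr
    rw [← sq.fac_right] at hk
    obtain ⟨L, j, hj⟩ := hk.of_comp' hE
    refine hj.defl (h.right_iff.2 fun C hC M i c hc => ?_)
    have := hp i (hc.infl hC)
    have sq' : CommSq j i p 0 := ⟨by simp [hj.zero]⟩
    obtain ⟨t, ht⟩ := hj.exists_lift sq'.lift sq'.fac_right
    have := hj.mono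
    exact hc.exists_section (r := t) (by rw [← cancel_mono j, Category.assoc, ht]; simp)
  · refine le_antisymm (fun Z W i hi => ?_) fun Z W i hi Y Y' p hp => lift i p hi hp
    obtain ⟨V, l, r, hl, hr, fac⟩ := h.exists_factorization hE i
    have := hi r hr
    have sq : CommSq l i r (𝟙 W) := ⟨by simp [fac]⟩
    obtain ⟨K, k, hk, -⟩ := infl_iff.1 hl
    rw [← sq.fac_left] at hk
    obtain ⟨L, j, hj⟩ := hk.of_comp hE
    refine hj.infl (h.left_iff.2 fun K hK M k p hp => ?_)
    have := hi p (hp.defl hK)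
    have sq' : CommSq 0 i p j := ⟨by simp [hj.zero]⟩
    obtain ⟨t, ht⟩ := hj.exists_desc sq'.lift sq'.fac_left
    have := hj.epi
    exact ⟨t, by rw [← cancel_epi j, reassoc_of% ht]; simp⟩
  · obtain ⟨V, i, p, hi, hp, fac⟩ := h.exists_factorization hE f
    exact ⟨{ Z := V, i := i, p := p, fac := fac, hi := hi, hp := hp }⟩
  · have e : fromZero (X.Infl A) = A := by ext; exact infl_zero_iff
    rw [e]
  · have e : toZero (X.Defl B) = B := by ext; exact defl_zero_iff
    rw [e]

end IsCompleteCotorsionPair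

/-- An exact weak factorization system gives a complete cotorsion pair. -/
lemma IsExactWFS.isCompleteCotorsionPair {L R : MorphismProperty E} (h : X.IsExactWFS L R) :
    X.IsCompleteCotorsionPair (fromZero L) (toZero R) := by
  have := h.isWeakFactorizationSystem
  have orth : ∀ A B, fromZero L A → toZero R B → X.Orth A B := by
    intro A B hA hB M i p hp
    have := MorphismProperty.hasLiftingProperty_of_wfs _ p hA ((h.mem_right_iff p).2 (hp.defl hB))
    have sq : CommSq 0 (0 : (0 : E) ⟶ A) p (𝟙 A) := ⟨by simp⟩
    exact ⟨sq.lift, sq.fac_right⟩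
  refine ⟨?_, ?_, fun Y => ?_, fun Y => ?_⟩
  · ext Y
    rw [leftPerp_iff]
    refine ⟨fun hY B hB => orth Y B hY hB, fun hY => ?_⟩
    rw [fromZero, ← MorphismProperty.llp_eq_of_wfs L R]
    intro Z W p hp
    obtain ⟨K, k, hk, hK⟩ := defl_iff.1 ((h.mem_right_iff p).1 hp)
    exact (hY K hK).hasLiftingProperty (X.conf_zero_id Y) hk
  · ext Y
    rw [rightPerp_iff]
    refine ⟨fun hY => ?_, fun hY A hA => orth A Y hA hY⟩
    rw [toZero, ← MorphismProperty.rlp_eq_of_wfs L R]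
    intro Z W i hi
    obtain ⟨K, k, hk, hK⟩ := infl_iff.1 ((h.mem_left_iff i).1 hi)
    exact (hY K hK).hasLiftingProperty hk (X.conf_id_zero Y)
  · let d := MorphismProperty.factorizationData L R (0 : Y ⟶ (0 : E))
    obtain ⟨C, p, ⟨w, hp⟩, hC⟩ := infl_iff.1 ((h.mem_left_iff d.i).1 d.hi)
    have e : d.p = 0 := (isZero_zero E).eq_of_tgt _ _
    exact ⟨_, _, _, _, w, hp, by rw [toZero, ← e]; exact d.hp, hC⟩
  · let d := MorphismProperty.factorizationData L R (0 : (0 : E) ⟶ Y)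
    obtain ⟨C, p, ⟨w, hp⟩, hC⟩ := defl_iff.1 ((h.mem_right_iff d.p).1 d.hp)
    have e : d.i = 0 := (isZero_zero E).eq_of_src _ _
    exact ⟨_, _, _, _, w, hp, hC, by rw [fromZero, ← e]; exact d.hi⟩

end Orthogonality
end ExactStructure

namespace ExactStructure

/-! ### Morphisms with trivial cone -/

section TrivialCone

variable {E : Type u} [Category.{v} E] [Preadditive E] [HasZeroObject E] [HasBinaryBiproducts E]
  {X : ExactStructure E}

namespace HasTwoOutOfThree

variable {W : ObjectProperty E} (hW : X.HasTwoOutOfThree W) {A B C : E} {i : A ⟶ B} {p : B ⟶ C}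

include hW

lemma iff_left (h : X.Conf i p) (hA : W A) : W B ↔ W C :=
  ⟨hW.right _ h.2 hA, hW.middle _ h.2 hA⟩

lemma iff_middle (h : X.Conf i p) (hB : W B) : W A ↔ W C :=
  ⟨fun hA => hW.right _ h.2 hA hB, hW.left _ h.2 hB⟩

end HasTwoOutOfThree

variable (X) in
/-- The morphisms `w : A ⟶ B` such that `(w, j) : A ⟶ B ⊞ J` has a cokernel in `W` for some
inflation `j : A ⟶ J` with `J` in `W`. -/
def trivialCone (W : ObjectProperty E) : MorphismProperty E :=
  fun A B w => ∃ (J C D : E) (j : A ⟶ J) (p : J ⟶ C) (q : B ⊞ J ⟶ D),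
    X.Conf j p ∧ W J ∧ X.Conf (biprod.lift w j) q ∧ W D

lemma Conf.exists_map_id {K A B : E} {k : K ⟶ A} {g : A ⟶ B} (h : X.Conf k g) (D : E) :
    ∃ i, X.Conf i (biprod.map (𝟙 D) g) ∧ i ≫ biprod.snd = k := by
  refine h.of_isPullback (g := biprod.snd) ⟨⟨by simp⟩, ⟨PullbackCone.IsLimit.mk _
    (fun c => biprod.lift (c.snd ≫ biprod.fst) c.fst) (fun c => by simp) (fun c => ?_)
    fun c m hl hr => ?_⟩⟩
  · ext <;> simp [c.condition]
  · ext <;> simp [← hl, ← hr]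

lemma Conf.exists_map {A A' B B' C C' : E} {i : A ⟶ B} {p : B ⟶ C} (h : X.Conf i p)
    {i' : A' ⟶ B'} {p' : B' ⟶ C'} (h' : X.Conf i' p') :
    ∃ (D : E) (q : B ⊞ B' ⟶ D), X.Conf (biprod.map i i') q := by
  have h1 : X.Conf (biprod.map i (𝟙 A')) ((biprod.braiding _ _).inv ≫ biprod.snd ≫ p) :=
    (h.map_id A').of_iso (biprod.braiding _ _) (biprod.braiding _ _) (Iso.refl _)
      (by ext <;> simp) (by simp)
  have e : biprod.map i (𝟙 A') ≫ biprod.map (𝟙 B) i' = biprod.map i i' := by ext <;> simp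
  exact e ▸ h1.exists_comp (h'.map_id B)

/-- `W` contains enough targets of inflations. -/
def HasEnough (X : ExactStructure E) (W : ObjectProperty E) : Prop :=
  ∀ Y : E, ∃ (J C : E) (j : Y ⟶ J) (p : J ⟶ C), X.Conf j p ∧ W J

section

variable {W : ObjectProperty E} (hW : X.HasTwoOutOfThree W) [W.IsClosedUnderIsomorphisms]

include hW

/-- Lifting `j` through a deflation with kernel `K` changes the cone by a conflation `K ⟶ D' ⟶ D`.
-/
lemma cone_iff_of_deflation {A B J D K N D' : E} {w : A ⟶ B} {j : A ⟶ J} {q : B ⊞ J ⟶ D}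
    (hq : X.Conf (biprod.lift w j) q) {k : K ⟶ N} {g : N ⟶ J} (hg : X.Conf k g) (hK : W K)
    {n : A ⟶ N} (hn : n ≫ g = j) {q' : B ⊞ N ⟶ D'} (hq' : X.Conf (biprod.lift w n) q') :
    W D ↔ W D' := by
  obtain ⟨i, hi, -⟩ := hg.exists_map_id B
  have e : biprod.lift w n ≫ biprod.map (𝟙 B) g = biprod.lift w j := by ext <;> simp [hn]
  obtain ⟨C, c, b, hc, hb, -⟩ := hi.of_comp_deflation (e.symm ▸ hq)
  obtain ⟨e, -⟩ := hc.cokernel_iso hq'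
  rw [← hW.iff_left hb hK, W.prop_iff_of_iso e]

/-- The class `trivialCone W` can be tested on any inflation into an object of `W`. -/
lemma trivialCone_iff {A B J C D : E} {w : A ⟶ B} {j : A ⟶ J} {p : J ⟶ C} (hj : X.Conf j p)
    (hJ : W J) {q : B ⊞ J ⟶ D} (hq : X.Conf (biprod.lift w j) q) :
    X.trivialCone W w ↔ W D := by
  refine ⟨?_, fun hD => ⟨_, _, _, _, _, _, hj, hJ, hq, hD⟩⟩
  rintro ⟨J', C', D', j', p', q', hj', hJ', hq', hD'⟩
  -- The inflation `(j', j)` into `J' ⊞ J` lifts both choices, and the two projections have kernels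
  -- in `W`.
  obtain ⟨N, n, hn⟩ := hj.exists_lift_conf j'
  obtain ⟨D'', q'', hq''⟩ := hn.exists_lift_conf w
  have h₁ : X.Conf (biprod.inl : J' ⟶ J' ⊞ J) biprod.snd :=
    X.conf_of_split _ _ biprod.fst biprod.inr (by simp) (by simp) (by simp) biprod.total
  have h₂ : X.Conf (biprod.inr : J ⟶ J' ⊞ J) biprod.fst :=
    X.conf_of_split _ _ biprod.snd biprod.inl (by simp) (by simp) (by simp)
      (by rw [add_comm, biprod.total])
  rw [cone_iff_of_deflation hW hq h₁ hJ' (by simp) hq'',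
    ← cone_iff_of_deflation hW hq' h₂ hJ (by simp) hq'']
  exact hD'

variable (hX : X.HasEnough W)

include hX

/-- An inflation has trivial cone if and only if its cokernel is in `W`. -/
lemma Conf.trivialCone_iff_cokernel {A B V : E} {i : A ⟶ B} {p : B ⟶ V} (h : X.Conf i p) :
    X.trivialCone W i ↔ W V := by
  obtain ⟨J, C, j, c, hj, hJ⟩ := hX A
  have h₂ : X.Conf (biprod.inr : J ⟶ B ⊞ J) biprod.fst :=
    X.conf_of_split _ _ biprod.snd biprod.inl (by simp) (by simp) (by simp)
      (by rw [add_comm, biprod.total])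
  have e : biprod.lift i j ≫ biprod.fst = i := by simp
  obtain ⟨D, d, b, hd, hb, -⟩ := h₂.of_comp_deflation (e.symm ▸ h)
  rw [trivialCone_iff hW hj hJ hd, hW.iff_left hb hJ]

/-- A deflation has trivial cone if and only if its kernel is in `W`. -/
lemma Conf.trivialCone_iff_kernel {V A B : E} {k : V ⟶ A} {p : A ⟶ B} (h : X.Conf k p) :
    X.trivialCone W p ↔ W V := by
  obtain ⟨J, C, j, c, hj, hJ⟩ := hX A
  -- `M = Coker (k ≫ j)` is also the pushout of `j` along `p`, hence the cone of `p`; compare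
  -- through `V ⟶ J ⟶ M`.
  obtain ⟨M, π, a, b, hπ, -, sq, -⟩ := h.comp hj
  rw [trivialCone_iff hW hj hJ (hj.lift_of_isPushout sq), hW.iff_middle hπ hJ]

/-- The octahedral axiom: `(f, j)` followed by `(g, k) ⊕ 1` is `(f ≫ g, (f ≫ k, j))`, so `Coker` of
this composite of inflations is a cone of `f ≫ g`, and Noether's isomorphism relates the three
cones. -/
lemma exists_cone_conflation {A B C : E} (f : A ⟶ B) (g : B ⟶ C) :
    ∃ (D M D' : E) (a : D ⟶ M) (b : M ⟶ D'), X.Conf a b ∧ (X.trivialCone W f ↔ W D) ∧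
      (X.trivialCone W (f ≫ g) ↔ W M) ∧ (X.trivialCone W g ↔ W D') := by
  obtain ⟨J, _, j, _, hj, hJ⟩ := hX A
  obtain ⟨K, _, k, _, hk, hK⟩ := hX B
  obtain ⟨D, q, hq⟩ := hj.exists_lift_conf f
  obtain ⟨D', q', hq'⟩ := hk.exists_lift_conf g
  obtain ⟨_, _, hn⟩ := hj.exists_lift_conf (f ≫ k)
  let a := biprod.braiding J B
  let b := biprod.braiding J (C ⊞ K) ≪≫ biprod.associator C K J
  have hφ : X.Conf (a.inv ≫ biprod.map (𝟙 J) (biprod.lift g k) ≫ b.hom)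
      (b.inv ≫ biprod.snd ≫ q') :=
    (hq'.map_id J).of_iso a b (Iso.refl _) (by simp) (by simp)
  obtain ⟨M, π, x, y, hπ, hxy, -⟩ := hq.comp hφ
  have e : biprod.lift f j ≫ a.inv ≫ biprod.map (𝟙 J) (biprod.lift g k) ≫ b.hom =
      biprod.lift (f ≫ g) (biprod.lift (f ≫ k) j) := by
    ext <;> simp [a, b]
  rw [e] at hπ
  have hKJ : W (K ⊞ J) := hW.middle _ (X.conf_of_split (biprod.inl : K ⟶ K ⊞ J) biprod.snd
    biprod.fst biprod.inr (by simp) (by simp) (by simp) biprod.total).2 hK hJ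
  exact ⟨D, M, D', x, y, hxy, trivialCone_iff hW hj hJ hq, trivialCone_iff hW hn hKJ hπ,
    trivialCone_iff hW hk hK hq'⟩

lemma trivialCone_hasTwoOutOfThreeProperty : (X.trivialCone W).HasTwoOutOfThreeProperty where
  comp_mem f g hf hg := by
    obtain ⟨D, M, D', a, b, h, h₁, h₂, h₃⟩ := exists_cone_conflation hW hX f g
    exact h₂.2 (hW.middle _ h.2 (h₁.1 hf) (h₃.1 hg))
  of_postcomp f g hg hfg := by
    obtain ⟨D, M, D', a, b, h, h₁, h₂, h₃⟩ := exists_cone_conflation hW hX f g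
    exact h₁.2 (hW.left _ h.2 (h₂.1 hfg) (h₃.1 hg))
  of_precomp f g hf hfg := by
    obtain ⟨D, M, D', a, b, h, h₁, h₂, h₃⟩ := exists_cone_conflation hW hX f g
    exact h₃.2 (hW.right _ h.2 (h₁.1 hf) (h₂.1 hfg))

lemma trivialCone_isStableUnderRetracts [W.IsStableUnderRetracts]
    (hE : WeaklyIdempotentComplete E) : (X.trivialCone W).IsStableUnderRetracts where
  of_retract {A B A' B'} f g h hg := by
    obtain ⟨J, _, j, _, hj, hJ⟩ := hX A
    obtain ⟨K, _, k, _, hk, hK⟩ := hX A'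
    obtain ⟨D, q, hq⟩ := hj.exists_lift_conf f
    obtain ⟨s, r, u, v, hsr, huv, hu, hv⟩ : ∃ (s : A ⟶ A') (r : A' ⟶ A) (u : B ⟶ B')
        (v : B' ⟶ B), s ≫ r = 𝟙 A ∧ u ≫ v = 𝟙 B ∧ s ≫ g = f ≫ u ∧ r ≫ f = g ≫ v :=
      ⟨h.i.left, h.r.left, h.i.right, h.r.right, h.retract_left, h.retract_right, h.i_w, h.r_w⟩
    -- The retraction must be compatible with the chosen inflations. The map `n = (r ≫ j, (1 - r ≫
    -- s) ≫ k)` satisfies `s ≫ n = (j, 0)` and `n ≫ fst = r ≫ j`, so the cone of `f` is a retract of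
    -- that of `g`. It is an inflation: a split monomorphism followed by `j ⊕ k`.
    have hsplit : biprod.lift r (𝟙 A' - r ≫ s) ≫ biprod.desc s (𝟙 A') = 𝟙 A' := by simp
    obtain ⟨_, _, h1⟩ := Conf.of_comp hE (hsplit.symm ▸ X.conf_id_zero A')
    obtain ⟨_, _, h2⟩ := hj.exists_map hk
    obtain ⟨_, _, h3⟩ := h1.exists_comp h2
    let n := biprod.lift r (𝟙 A' - r ≫ s) ≫ biprod.map j k
    have hJK : W (J ⊞ K) := hW.middle _ (X.conf_of_split (biprod.inl : J ⟶ J ⊞ K) biprod.snd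
      biprod.fst biprod.inr (by simp) (by simp) (by simp) biprod.total).2 hJ hK
    obtain ⟨D', q', hq'⟩ := h3.exists_lift_conf g
    have hD' := (trivialCone_iff hW h3 hJK hq').1 hg
    have e₁ : biprod.lift f j ≫ biprod.map u biprod.inl = s ≫ biprod.lift g n := by
      ext <;> simp [n, reassoc_of% hsr, hu]
    have e₂ : biprod.lift g n ≫ biprod.map v biprod.fst = r ≫ biprod.lift f j := by
      ext <;> simp [n, hv]
    have e₃ : biprod.map u (biprod.inl : J ⟶ J ⊞ K) ≫ biprod.map v biprod.fst = 𝟙 _ := by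
      ext <;> simp [huv]
    obtain ⟨d, hd⟩ := hq.exists_desc (biprod.map u biprod.inl ≫ q') (by
      rw [reassoc_of% e₁, hq'.zero, comp_zero])
    obtain ⟨d', hd'⟩ := hq'.exists_desc (biprod.map v biprod.fst ≫ q) (by
      rw [reassoc_of% e₂, hq.zero, comp_zero])
    have := hq.epi
    have hdd : d ≫ d' = 𝟙 D := by
      rw [← cancel_epi q, reassoc_of% hd, hd', reassoc_of% e₃, Category.comp_id]
    exact (trivialCone_iff hW hj hJ hq).2 (W.prop_of_retract ⟨d, d', hdd⟩ hD')

lemma trivialCone_iff_exists_factorization {S : ObjectProperty E}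
    (hfac : ∀ ⦃A B : E⦄ (f : A ⟶ B), ∃ (V : E) (i : A ⟶ V) (p : V ⟶ B),
      X.Infl S i ∧ X.Defl W p ∧ i ≫ p = f) {A B : E} (w : A ⟶ B) :
    X.trivialCone W w ↔ ∃ (V : E) (wi : A ⟶ V) (wd : V ⟶ B),
      X.Infl W wi ∧ X.Defl W wd ∧ wi ≫ wd = w := by
  have := trivialCone_hasTwoOutOfThreeProperty hW hX
  constructor
  · intro hw
    obtain ⟨V, i, p, hi, hp, rfl⟩ := hfac w
    obtain ⟨K, k, hk, hK⟩ := defl_iff.1 hp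
    obtain ⟨C, c, hc, -⟩ := infl_iff.1 hi
    refine ⟨V, i, p, hc.infl ?_, hp, rfl⟩
    rw [← hc.trivialCone_iff_cokernel hW hX]
    exact (X.trivialCone W).of_postcomp i p ((hk.trivialCone_iff_kernel hW hX).2 hK) hw
  · rintro ⟨V, i, p, hi, hp, rfl⟩
    obtain ⟨K, k, hk, hK⟩ := defl_iff.1 hp
    obtain ⟨C, c, hc, hC⟩ := infl_iff.1 hi
    exact (X.trivialCone W).comp_mem _ _ ((hc.trivialCone_iff_cokernel hW hX).2 hC)
      ((hk.trivialCone_iff_kernel hW hX).2 hK)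

end

end TrivialCone
end ExactStructure

namespace ExactStructure

/-! ### Hovey triples and exact model structures -/

section Correspondence

variable {E : Type u} [Category.{v} E] [Preadditive E] [HasZeroObject E] [HasBinaryBiproducts E]
  {X : ExactStructure E}

namespace HoveyTriple

variable (T : X.HoveyTriple)

instance : T.W.IsStableUnderRetracts := T.isStableUnderRetracts

instance : T.W.IsClosedUnderIsomorphisms :=
  ⟨fun e h => T.W.prop_of_retract ⟨e.inv, e.hom, e.inv_hom_id⟩ h⟩

instance : T.C.IsClosedUnderIsomorphisms :=
  T.isCompleteCotorsionPair_cof.isClosedUnderIsomorphisms_left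

instance : T.F.IsClosedUnderIsomorphisms :=
  T.isCompleteCotorsionPair_fib.isClosedUnderIsomorphisms_right

lemma hasEnough : X.HasEnough T.W := fun Y => by
  obtain ⟨B, A, i, p, w, h, hB, -⟩ := T.isCompleteCotorsionPair_cof.exists_left_approx Y
  exact ⟨B, A, i, p, ⟨w, h⟩, hB.1⟩

/-- The exact model structure attached to a Hovey triple. -/
def toExactModelStructure (hE : WeaklyIdempotentComplete E) : X.ExactModelStructure where
  cof := X.Infl T.C
  weq := X.trivialCone T.W
  fib := X.Defl T.F
  weq_isStableUnderRetracts :=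
    trivialCone_isStableUnderRetracts T.hasTwoOutOfThree T.hasEnough hE
  weq_hasTwoOutOfThreeProperty :=
    trivialCone_hasTwoOutOfThreeProperty T.hasTwoOutOfThree T.hasEnough
  isExactWFS_cof_trivialFib := by
    have e : X.trivialCone T.W ⊓ X.Defl T.F = X.Defl (T.W ⊓ T.F) := by
      ext A B f
      rw [defl_inf_iff]
      refine and_congr_left fun hf => ?_
      obtain ⟨K, k, hk, -⟩ := defl_iff.1 hf
      rw [hk.trivialCone_iff_kernel T.hasTwoOutOfThree T.hasEnough, hk.defl_iff]
    rw [e]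
    exact T.isCompleteCotorsionPair_cof.isExactWFS hE
  isExactWFS_trivialCof_fib := by
    have e : X.Infl T.C ⊓ X.trivialCone T.W = X.Infl (T.C ⊓ T.W) := by
      ext A B f
      rw [infl_inf_iff]
      refine and_congr_right fun hf => ?_
      obtain ⟨K, k, hk, -⟩ := infl_iff.1 hf
      rw [hk.trivialCone_iff_cokernel T.hasTwoOutOfThree T.hasEnough, hk.infl_iff]
    rw [e]
    exact T.isCompleteCotorsionPair_fib.isExactWFS hE

lemma trivialCone_iff_exists (hE : WeaklyIdempotentComplete E) {A B : E} (w : A ⟶ B) :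
    X.trivialCone T.W w ↔ ∃ (V : E) (wi : A ⟶ V) (wd : V ⟶ B),
      X.Infl T.W wi ∧ X.Defl T.W wd ∧ wi ≫ wd = w := by
  refine trivialCone_iff_exists_factorization T.hasTwoOutOfThree T.hasEnough (S := T.C)
    (fun A B f => ?_) w
  obtain ⟨V, i, p, hi, hp, fac⟩ := T.isCompleteCotorsionPair_cof.exists_factorization hE f
  exact ⟨V, i, p, hi, (defl_inf_iff.1 hp).1, fac⟩

end HoveyTriple

attribute [ext] HoveyTriple ExactModelStructure

namespace ExactModelStructure

variable (M : X.ExactModelStructure)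

instance : M.weq.IsStableUnderRetracts := M.weq_isStableUnderRetracts

instance : M.weq.HasTwoOutOfThreeProperty := M.weq_hasTwoOutOfThreeProperty

instance : M.cof.IsWeakFactorizationSystem (M.weq ⊓ M.fib) :=
  M.isExactWFS_cof_trivialFib.isWeakFactorizationSystem

instance : (M.cof ⊓ M.weq).IsWeakFactorizationSystem M.fib :=
  M.isExactWFS_trivialCof_fib.isWeakFactorizationSystem

/-- Identities lift against everything, so they are trivial cofibrations. -/
lemma weq_id (A : E) : M.weq (𝟙 A) := by
  have : (M.cof ⊓ M.weq) (𝟙 A) := by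
    rw [← MorphismProperty.llp_eq_of_wfs (M.cof ⊓ M.weq) M.fib]
    intro Y Z p hp
    infer_instance
  exact this.2

/-- Apply 2-out-of-3 to `0 ⟶ A ⟶ 0`. This lets `W` be the same class in both cotorsion pairs. -/
lemma fromZero_weq_iff {A : E} : fromZero M.weq A ↔ toZero M.weq A := by
  have e : (0 : (0 : E) ⟶ A) ≫ (0 : A ⟶ (0 : E)) = 𝟙 _ := (isZero_zero E).eq_of_src _ _
  have h : M.weq ((0 : (0 : E) ⟶ A) ≫ (0 : A ⟶ (0 : E))) := e ▸ M.weq_id _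
  exact ⟨fun hA => M.weq.of_precomp _ _ hA h, fun hA => M.weq.of_postcomp _ _ hA h⟩

lemma toZero_inf : toZero (M.weq ⊓ M.fib) = fromZero M.weq ⊓ toZero M.fib := by
  ext A
  exact and_congr_left fun _ => M.fromZero_weq_iff.symm

lemma isCompleteCotorsionPair_cof :
    X.IsCompleteCotorsionPair (fromZero M.cof) (toZero (M.weq ⊓ M.fib)) :=
  M.isExactWFS_cof_trivialFib.isCompleteCotorsionPair

lemma isCompleteCotorsionPair_fib :
    X.IsCompleteCotorsionPair (fromZero (M.cof ⊓ M.weq)) (toZero M.fib) :=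
  M.isExactWFS_trivialCof_fib.isCompleteCotorsionPair

variable {A B C : E} {i : A ⟶ B} {p : B ⟶ C}

/-- An inflation is a weak equivalence if and only if its cokernel is trivial. -/
lemma weq_inflation_iff (h : X.Conf i p) : M.weq i ↔ fromZero M.weq C := by
  have := M.isCompleteCotorsionPair_cof.isClosedUnderIsomorphisms_left
  have := M.isCompleteCotorsionPair_fib.isClosedUnderIsomorphisms_left
  -- With `i` factored as a cofibration and a trivial fibration, `b : Coker d.i ⟶ C` has the same
  -- kernel `K` as `d.p`, so it is a trivial fibration too. This reduces the claim to the
  -- cofibration `d.i`, where comparing the two exact weak factorization systems decides it.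
  let d := MorphismProperty.factorizationData M.cof (M.weq ⊓ M.fib) i
  obtain ⟨K, k, hk, hK⟩ := defl_iff.1 ((M.isExactWFS_cof_trivialFib.mem_right_iff d.p).1 d.hp)
  obtain ⟨D, c, b, hc, hb, -⟩ := hk.of_comp_deflation (d.fac.symm ▸ h)
  have hb' := (M.isExactWFS_cof_trivialFib.mem_right_iff b).2 (hb.defl hK)
  have h₁ := (M.isExactWFS_cof_trivialFib.mem_left_iff d.i).trans hc.infl_iff
  have h₂ := (M.isExactWFS_trivialCof_fib.mem_left_iff d.i).trans hc.infl_iff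
  have h₃ : M.weq d.i ↔ fromZero M.weq D :=
    ⟨fun hw => (h₂.1 ⟨d.hi, hw⟩).2, fun hD => (h₂.2 ⟨h₁.1 d.hi, hD⟩).2⟩
  have h₄ : M.weq i ↔ M.weq d.i := by
    conv_lhs => rw [← d.fac]
    exact M.weq.postcomp_iff (W' := M.weq) _ _ d.hp.1
  have h₅ : (0 : (0 : E) ⟶ D) ≫ b = 0 := zero_comp
  rw [h₄, h₃, fromZero, fromZero, ← h₅]
  exact (M.weq.postcomp_iff (W' := M.weq) _ _ hb'.1).symm

/-- A deflation is a weak equivalence if and only if its kernel is trivial. -/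
lemma weq_deflation_iff (h : X.Conf i p) : M.weq p ↔ fromZero M.weq A := by
  have := M.isCompleteCotorsionPair_cof.isClosedUnderIsomorphisms_right
  have := M.isCompleteCotorsionPair_fib.isClosedUnderIsomorphisms_right
  let d := MorphismProperty.factorizationData (M.cof ⊓ M.weq) M.fib p
  obtain ⟨K, k, hk, hK⟩ := infl_iff.1 ((M.isExactWFS_trivialCof_fib.mem_left_iff d.i).1 d.hi)
  obtain ⟨D, c, b, hc, hb, -⟩ := hk.of_inflation_comp (d.fac.symm ▸ h)
  have hb' := (M.isExactWFS_trivialCof_fib.mem_left_iff b).2 (hb.infl hK)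
  have h₁ := (M.isExactWFS_trivialCof_fib.mem_right_iff d.p).trans hc.defl_iff
  have h₂ := (M.isExactWFS_cof_trivialFib.mem_right_iff d.p).trans hc.defl_iff
  have h₃ : M.weq d.p ↔ toZero M.weq D :=
    ⟨fun hw => (h₂.1 ⟨hw, d.hp⟩).1, fun hD => (h₂.2 ⟨hD, h₁.1 d.hp⟩).1⟩
  have h₄ : M.weq p ↔ M.weq d.p := by
    conv_lhs => rw [← d.fac]
    exact M.weq.precomp_iff (W' := M.weq) _ _ d.hi.2
  have h₅ : b ≫ (0 : D ⟶ (0 : E)) = 0 := comp_zero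
  rw [h₄, h₃, fromZero_weq_iff, toZero, toZero, ← h₅]
  exact (M.weq.precomp_iff (W' := M.weq) _ _ hb'.2).symm

/-- If the first term is trivial, the deflation is a weak equivalence; if the third is, the
inflation is. Composing with maps from `0` then transfers triviality. -/
lemma hasTwoOutOfThree : X.HasTwoOutOfThree (fromZero M.weq) := by
  have key : ∀ S : ShortComplex E, X.conflation S → fromZero M.weq S.X₁ →
      (fromZero M.weq S.X₂ ↔ fromZero M.weq S.X₃) := by
    intro S hS h
    have hg := (M.weq_deflation_iff (A := S.X₁) (i := S.f) ⟨S.zero, hS⟩).2 h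
    rw [fromZero, fromZero, ← (zero_comp : (0 : (0 : E) ⟶ S.X₂) ≫ S.g = 0)]
    exact (M.weq.postcomp_iff (W' := M.weq) _ _ hg).symm
  refine ⟨fun S hS h₂ h₃ => ?_, fun S hS h₁ h₃ => (key S hS h₁).2 h₃,
    fun S hS h₁ h₂ => (key S hS h₁).1 h₂⟩
  have hf := (M.weq_inflation_iff (C := S.X₃) (p := S.g) ⟨S.zero, hS⟩).2 h₃
  refine M.weq.of_postcomp _ S.f hf ?_
  rw [zero_comp]
  exact h₂

/-- The Hovey triple attached to an exact model structure. -/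
def toHoveyTriple : X.HoveyTriple where
  C := fromZero M.cof
  W := fromZero M.weq
  F := toZero M.fib
  isStableUnderRetracts := ⟨fun {Y Z} h hZ =>
    M.weq.of_retract (f := (0 : (0 : E) ⟶ Y)) (g := (0 : (0 : E) ⟶ Z))
      ⟨Arrow.homMk' (𝟙 _) h.i (by simp), Arrow.homMk' (𝟙 _) h.r (by simp), by
        ext
        · exact Category.comp_id _
        · exact h.retract⟩ hZ⟩
  hasTwoOutOfThree := M.hasTwoOutOfThree
  isCompleteCotorsionPair_cof := M.toZero_inf ▸ M.isCompleteCotorsionPair_cof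
  isCompleteCotorsionPair_fib := M.isCompleteCotorsionPair_fib

lemma weq_iff_exists {Y Z : E} (w : Y ⟶ Z) :
    M.weq w ↔ ∃ (V : E) (wi : Y ⟶ V) (wd : V ⟶ Z),
      X.Infl (fromZero M.weq) wi ∧ X.Defl (fromZero M.weq) wd ∧ wi ≫ wd = w := by
  constructor
  · intro hw
    let d := MorphismProperty.factorizationData M.cof (M.weq ⊓ M.fib) w
    obtain ⟨K, k, hk, hK⟩ := defl_iff.1 ((M.isExactWFS_cof_trivialFib.mem_right_iff d.p).1 d.hp)
    obtain ⟨C, c, hc, hC⟩ := infl_iff.1 ((M.isExactWFS_cof_trivialFib.mem_left_iff d.i).1 d.hi)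
    refine ⟨d.Z, d.i, d.p, hc.infl ?_, hk.defl (M.fromZero_weq_iff.2 hK.1), d.fac⟩
    rw [← M.weq_inflation_iff hc]
    exact M.weq.of_postcomp _ d.p d.hp.1 (by rwa [d.fac])
  · rintro ⟨V, i, p, hi, hp, rfl⟩
    obtain ⟨K, k, hk, hK⟩ := defl_iff.1 hp
    obtain ⟨C, c, hc, hC⟩ := infl_iff.1 hi
    exact M.weq.comp_mem _ _ ((M.weq_inflation_iff hc).2 hC) ((M.weq_deflation_iff hk).2 hK)

end ExactModelStructure

variable (X) in
/-- The correspondence between Hovey triples and exact model structures. -/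
def hoveyEquiv (hE : WeaklyIdempotentComplete E) : X.HoveyTriple ≃ X.ExactModelStructure where
  toFun T := T.toExactModelStructure hE
  invFun M := M.toHoveyTriple
  left_inv T := by
    ext A
    · exact infl_zero_iff
    · exact (X.conf_zero_id A).trivialCone_iff_cokernel T.hasTwoOutOfThree T.hasEnough
    · exact defl_zero_iff
  right_inv M := by
    ext A B f
    · exact (M.isExactWFS_cof_trivialFib.mem_left_iff f).symm
    -- Both classes consist of the same inflation-deflation composites, determined by the trivial
    -- objects.
    · exact (M.toHoveyTriple.trivialCone_iff_exists hE f).trans (M.weq_iff_exists f).symm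
    · exact (M.isExactWFS_trivialCof_fib.mem_right_iff f).symm

end Correspondence
end ExactStructure

theorem mainTheorem7 {E : Type u} [Category.{v} E] [Preadditive E] [HasZeroObject E]
    [HasBinaryBiproducts E] (X : ExactStructure E) (hE : WeaklyIdempotentComplete E) :
    ∃ e : X.HoveyTriple ≃ X.ExactModelStructure,
      (∀ T : X.HoveyTriple,
        (∀ ⦃Y Z : E⦄ (c : Y ⟶ Z), (e T).cof c ↔ X.Infl T.C c) ∧
        (∀ ⦃Y Z : E⦄ (w : Y ⟶ Z), (e T).weq w ↔
          ∃ (V : E) (wi : Y ⟶ V) (wd : V ⟶ Z), X.Infl T.W wi ∧ X.Defl T.W wd ∧ wi ≫ wd = w) ∧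
        (∀ ⦃Y Z : E⦄ (f : Y ⟶ Z), (e T).fib f ↔ X.Defl T.F f)) ∧
      (∀ M : X.ExactModelStructure,
        (∀ A : E, (e.symm M).C A ↔ M.cof (0 : (0 : E) ⟶ A)) ∧
        (∀ A : E, (e.symm M).W A ↔ M.weq (0 : (0 : E) ⟶ A)) ∧
        (∀ A : E, (e.symm M).F A ↔ M.fib (0 : A ⟶ (0 : E)))) := by
  exact ⟨X.hoveyEquiv hE,
    fun T => ⟨fun _ _ _ => Iff.rfl, fun _ _ w => T.trivialCone_iff_exists hE w,
      fun _ _ _ => Iff.rfl⟩,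
    fun M => ⟨fun _ => Iff.rfl, fun _ => Iff.rfl, fun _ => Iff.rfl⟩⟩
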